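/- Let $k\ge 1$, let $(X,d)$ be a nonempty compact metric space, let $\alpha:\mathbb R^k\curvearrowright X$ be a continuous action (so each $a\in\mathbb R^k$ acts by a uniformly continuous homeomorphism), let $\|\cdot\|$ be any norm on $\mathbb R^k$, and let $F_n=\{v\in\mathbb R^k:\|v\|\le n\}$. For $A\subset\mathbb R^k$, $\varepsilon>0$ and compact $K\subset X$ let $N_B(A,\varepsilon,K)$ be the minimal number of Bowen balls $\{y\in X:\sup_{a\in A}d(a\cdot x,a\cdot y)<\varepsilon\}$, $x\in X$, required to cover $K$. For a nondecreasing function $f:\mathbb R^+\to\mathbb R^+$ with $\lim_{x\to+\infty}f(x)=+\infty$, the upper topological slow entropy of $\alpha$ at scale $f$ is $$\sup_{K}\lim_{\varepsilon\to0}\limsup_{n\to\infty}\frac{\log N_B(F_n,\varepsilon,K)}{f(\operatorname{Leb}(F_n))},$$ the lower one is defined with $\liminf$ in place of $\limsup$, and the topological slow entropy $h^{\rm top}_{f,F_n}(\alpha)$ is their common value when they agree. If $\alpha$ is minimal (every orbit is dense), then $h^{\rm top}_{f,F_n}(\alpha)=0$ for every such $f$ if and only if $\alpha$ is topologically conjugate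 to an action by translations on a compact abelian group, i.e. there are a compact Hausdorff abelian topological group $G$, a continuous homomorphism $\varphi:\mathbb R^k\to G$ and a homeomorphism $h:X\to G$ with $h(a\cdot x)=\varphi(a)+h(x)$ for all $a\in\mathbb R^k$, $x\in X$. The "if" direction holds without the assumption that $\alpha$ is minimal. -/

import Mathlib

open Filter Topology MeasureTheory
open scoped ENNReal

noncomputable section

namespace SlowEntropy

/-- `ℝ^k`. -/
abbrev Rk (k : ℕ) : Type := Fin k → ℝ

section Bowen

variable {k : ℕ} {X : Type*} [MetricSpace X] [AddAction (Rk k) X]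

/-- The Bowen distance `sup_{a ∈ A} d(a · x, a · y)`, with values in `[0, ∞]`. -/
def bowenDist (A : Set (Rk k)) (x y : X) : ℝ≥0∞ :=
  ⨆ a ∈ A, edist (a +ᵥ x) (a +ᵥ y)

/-- The `A`-Bowen ball of radius `ε` around `x`. -/
def bowenBall (A : Set (Rk k)) (x : X) (ε : ℝ) : Set X :=
  {y | bowenDist A x y < ENNReal.ofReal ε}

/-- The minimal number of `A`-Bowen balls of radius `ε` required to cover `K`
(`⊤` if no finite number suffices). -/
def coverNumber (A : Set (Rk k)) (ε : ℝ) (K : Set X) : ℕ∞ :=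
  ⨅ (s : Finset X) (_ : K ⊆ ⋃ x ∈ s, bowenBall A x ε), (s.card : ℕ∞)

/-- The quotient `log N_B(A, ε, K) / f(Leb A)`, as an extended real number
(`log 0 = -∞`, `log ∞ = ∞`). -/
def growthRatio (f : ℝ → ℝ) (A : Set (Rk k)) (ε : ℝ) (K : Set X) : EReal :=
  ENNReal.log (coverNumber A ε K : ℝ≥0∞) / (f (volume A).toReal : EReal)

theorem bowenBall_mono (A : Set (Rk k)) (x : X) {ε δ : ℝ} (h : ε ≤ δ) :
    bowenBall A x ε ⊆ bowenBall A x δ :=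
  fun _ hy => lt_of_lt_of_le hy (ENNReal.ofReal_le_ofReal h)

theorem coverNumber_anti (A : Set (Rk k)) (K : Set X) {ε δ : ℝ} (h : ε ≤ δ) :
    coverNumber A δ K ≤ coverNumber A ε K :=
  le_iInf₂ fun s hs => iInf₂_le s
    (hs.trans (Set.iUnion₂_mono fun x _ => bowenBall_mono A x h))

end Bowen

/-- The scaling functions: nondecreasing `f : ℝ⁺ → ℝ⁺` with `f(x) → ∞` as `x → ∞`.
The values of `f` outside `(0, ∞)` are irrelevant. -/
structure IsScale (f : ℝ → ℝ) : Prop where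
  pos : ∀ x, 0 < x → 0 < f x
  mono : MonotoneOn f (Set.Ioi 0)
  tendsto : Tendsto f atTop atTop

/-- The sequence `F_n = {v : ‖v‖ ≤ n}` of balls of a norm `p` on `ℝ^k`. -/
def normBalls {k : ℕ} (p : Seminorm ℝ (Rk k)) (n : ℕ) : Set (Rk k) :=
  {v | p v ≤ n}

section Limit

variable {k : ℕ} {X : Type*} [MetricSpace X] [AddAction (Rk k) X]

theorem growthRatio_anti {f : ℝ → ℝ} {A : Set (Rk k)} (hf : 0 ≤ f (volume A).toReal)
    (K : Set X) {ε δ : ℝ} (h : ε ≤ δ) : growthRatio f A δ K ≤ growthRatio f A ε K := by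
  refine EReal.div_le_div_right_of_nonneg (by exact_mod_cast hf) (ENNReal.log_monotone ?_)
  exact_mod_cast coverNumber_anti A K h

/-- The limit of `limsup_n log N_B(F_n, ε, K) / f(Leb F_n)` as `ε → 0` exists and is the supremum
over `ε > 0`. -/
theorem tendsto_limsup_growthRatio {f : ℝ → ℝ} {F : ℕ → Set (Rk k)}
    (hF : ∀ᶠ n in atTop, 0 ≤ f (volume (F n)).toReal) (K : Set X) :
    Tendsto (fun ε : ℝ => limsup (fun n => growthRatio f (F n) ε K) atTop) (𝓝[>] 0)
      (𝓝 (⨆ (ε : ℝ) (_ : 0 < ε), limsup (fun n => growthRatio f (F n) ε K) atTop)) := by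
  have h : Antitone (fun ε : ℝ => limsup (fun n => growthRatio f (F n) ε K) atTop) :=
    fun _ _ hεδ => limsup_le_limsup (hF.mono fun _ hn => growthRatio_anti hn K hεδ)
  simpa [sSup_image] using h.tendsto_nhdsGT 0

/-- The same for `liminf`. -/
theorem tendsto_liminf_growthRatio {f : ℝ → ℝ} {F : ℕ → Set (Rk k)}
    (hF : ∀ᶠ n in atTop, 0 ≤ f (volume (F n)).toReal) (K : Set X) :
    Tendsto (fun ε : ℝ => liminf (fun n => growthRatio f (F n) ε K) atTop) (𝓝[>] 0)
      (𝓝 (⨆ (ε : ℝ) (_ : 0 < ε), liminf (fun n => growthRatio f (F n) ε K) atTop)) := by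
  have h : Antitone (fun ε : ℝ => liminf (fun n => growthRatio f (F n) ε K) atTop) :=
    fun _ _ hεδ => liminf_le_liminf (hF.mono fun _ hn => growthRatio_anti hn K hεδ)
  simpa [sSup_image] using h.tendsto_nhdsGT 0

end Limit

section Entropy

variable {k : ℕ} (X : Type*) [MetricSpace X] [AddAction (Rk k) X]

/-- The upper topological slow entropy at scale `f` along `F_n`:
`sup_K lim_{ε → 0} limsup_{n → ∞} log N_B(F_n, ε, K) / f(Leb F_n)`, over compact `K`. The limit
`ε → 0` is a monotone one and hence the supremum over `ε > 0`. -/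
def upperSlowEntropy (f : ℝ → ℝ) (F : ℕ → Set (Rk k)) : EReal :=
  ⨆ (K : Set X) (_ : IsCompact K) (ε : ℝ) (_ : 0 < ε),
    limsup (fun n => growthRatio f (F n) ε K) atTop

/-- The lower topological slow entropy: `limsup` is replaced by `liminf`. -/
def lowerSlowEntropy (f : ℝ → ℝ) (F : ℕ → Set (Rk k)) : EReal :=
  ⨆ (K : Set X) (_ : IsCompact K) (ε : ℝ) (_ : 0 < ε),
    liminf (fun n => growthRatio f (F n) ε K) atTop

/-- The topological slow entropy exists and equals `c`: the upper and the lower one agree, with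
common value `c`. -/
def HasSlowEntropy (f : ℝ → ℝ) (F : ℕ → Set (Rk k)) (c : EReal) : Prop :=
  upperSlowEntropy X f F = c ∧ lowerSlowEntropy X f F = c

end Entropy

universe u

/-- The action of `ℝ^k` on `X` is topologically conjugate to an action by translations on a
compact abelian group `G`: there are a continuous homomorphism `φ : ℝ^k → G` and a homeomorphism
`h : X → G` that carries the action of `a` to the translation by `φ a`. -/
def IsConjToTranslations (k : ℕ) (X : Type u) [TopologicalSpace X] [AddAction (Rk k) X] : Prop :=
  ∃ (G : Type u) (_ : AddCommGroup G) (_ : TopologicalSpace G) (_ : IsTopologicalAddGroup G)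
    (_ : CompactSpace G) (_ : T2Space G) (φ : Rk k →+ G) (h : X ≃ₜ G),
    Continuous φ ∧ ∀ (a : Rk k) (x : X), h (a +ᵥ x) = φ a + h x

end SlowEntropy

end

open Filter Topology MeasureTheory
open scoped ENNReal

/-! Slow entropy vanishes at every scale exactly when, for each ε, the covering numbers of X along
`F_n` stay bounded. If they were unbounded for some ε, one plus their logarithm, reparametrized by
volume, would itself be a scale, and at that scale the entropy is positive
(`bounded_coverNumber_of_hasSlowEntropy_zero`).

Boundedness passes by compactness to finite covers by closed Bowen balls of the whole group. Baire
and minimality then give equicontinuity (`uniformEquicontinuous_of_finite_cover`). For an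
equicontinuous action the uniformity pulled back along an orbit map makes ℝ^k a uniform group, and X
is its completion. Conversely, translations preserve differences, so a single finite cover serves
every set of group elements. -/

namespace SlowEntropy

/-! ### Volumes of norm balls -/

section Volume

open scoped Pointwise

variable {k : ℕ} (p : Seminorm ℝ (Rk k))

theorem continuous_seminorm : Continuous p :=
  continuousOn_univ.1 (p.convexOn.continuousOn isOpen_univ)

theorem normBalls_mono : Monotone (normBalls p) := fun m n h _ hv =>
  le_trans (show p _ ≤ (m : ℝ) from hv) (by exact_mod_cast h)

theorem normBalls_eq_smul {n : ℕ} (hn : n ≠ 0) : normBalls p n = (n : ℝ) • normBalls p 1 := by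
  have hn' : (0 : ℝ) < n := by positivity
  ext v
  rw [Set.mem_smul_set_iff_inv_smul_mem₀ hn'.ne']
  simp only [normBalls, Set.mem_ofPred_eq, map_smul_eq_mul, norm_inv, Real.norm_natCast,
    Nat.cast_one]
  rw [inv_mul_le_iff₀ hn', mul_one]

variable {p}

theorem isBounded_normBalls_one (hp : ∀ v, p v = 0 → v = 0) :
    Bornology.IsBounded (normBalls p 1) := by
  obtain ⟨m, hm, h⟩ := (isCompact_sphere (0 : Rk k) 1).exists_forall_le'
    (continuous_seminorm p).continuousOn (a := 0) fun v hv =>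
      lt_of_le_of_ne (apply_nonneg p v) fun h0 => by
        have := hp v h0.symm
        simp [this] at hv
  refine (Metric.isBounded_closedBall (x := (0 : Rk k)) (r := m⁻¹)).subset fun v hv => ?_
  rw [mem_closedBall_zero_iff]
  rcases eq_or_ne v 0 with rfl | hv0
  · simpa using hm.le
  have hpos : 0 < ‖v‖ := norm_pos_iff.2 hv0
  have h1 := h (‖v‖⁻¹ • v) (by simp [norm_smul, hpos.ne'])
  rw [map_smul_eq_mul, norm_inv, norm_norm, ← div_eq_inv_mul, le_div_iff₀ hpos] at h1
  have h2 : p v ≤ 1 := by simpa [normBalls] using hv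
  rw [← one_div, le_div_iff₀ hm, mul_comm]
  exact h1.trans h2

theorem volume_normBalls_one_pos (hp : ∀ v, p v = 0 → v = 0) :
    0 < (volume (normBalls p 1)).toReal := by
  refine ENNReal.toReal_pos (ne_of_gt ?_) (isBounded_normBalls_one hp).measure_lt_top.ne
  have ho : IsOpen {v | p v < 1} := isOpen_lt (continuous_seminorm p) continuous_const
  refine (ho.measure_pos volume ⟨0, by simp⟩).trans_le (measure_mono fun v hv => ?_)
  simpa [normBalls] using (show p v < 1 from hv).le

theorem volume_normBalls (hk : 1 ≤ k) (hp : ∀ v, p v = 0 → v = 0) (n : ℕ) :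
    (volume (normBalls p n)).toReal = (n : ℝ) ^ k * (volume (normBalls p 1)).toReal := by
  rcases eq_or_ne n 0 with rfl | hn
  · have h0 : normBalls p 0 = {0} := by
      ext v
      simp only [normBalls, Nat.cast_zero, Set.mem_ofPred_eq, Set.mem_singleton_iff]
      exact ⟨fun h => hp v (le_antisymm h (apply_nonneg p v)), fun h => by simp [h]⟩
    -- In positive dimension Lebesgue measure has no atoms.
    have : Nonempty (Fin k) := ⟨⟨0, hk⟩⟩
    simp [h0, show k ≠ 0 by omega]
  · rw [normBalls_eq_smul p hn, Measure.addHaar_smul, ENNReal.toReal_mul]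
    simp

theorem strictMono_volume_normBalls (hk : 1 ≤ k) (hp : ∀ v, p v = 0 → v = 0) :
    StrictMono fun n => (volume (normBalls p n)).toReal := fun m n h => by
  simp only [volume_normBalls hk hp m, volume_normBalls hk hp n]
  have := volume_normBalls_one_pos hp
  gcongr

theorem tendsto_volume_normBalls (hk : 1 ≤ k) (hp : ∀ v, p v = 0 → v = 0) :
    Tendsto (fun n => (volume (normBalls p n)).toReal) atTop atTop := by
  refine Tendsto.congr (fun n => (volume_normBalls hk hp n).symm) ?_
  exact ((tendsto_pow_atTop (by omega)).comp tendsto_natCast_atTop_atTop).atTop_mul_const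
    (volume_normBalls_one_pos hp)

end Volume

/-! ### Bowen balls and covering numbers -/

section Cover

variable {k : ℕ} {X : Type*} [MetricSpace X] [AddAction (Rk k) X]

theorem mem_bowenBall_of_forall_dist_le {A : Set (Rk k)} {x y : X} {δ ε : ℝ} (hε : 0 < ε)
    (hδ : δ < ε) (h : ∀ a ∈ A, dist (a +ᵥ x) (a +ᵥ y) ≤ δ) : y ∈ bowenBall A x ε := by
  refine lt_of_le_of_lt (iSup₂_le fun a ha => ?_) ((ENNReal.ofReal_lt_ofReal_iff hε).2 hδ)
  rw [edist_dist]
  exact ENNReal.ofReal_le_ofReal (h a ha)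

theorem dist_lt_of_mem_bowenBall {A : Set (Rk k)} {x y : X} {ε : ℝ} (h : y ∈ bowenBall A x ε)
    {a : Rk k} (ha : a ∈ A) : dist (a +ᵥ x) (a +ᵥ y) < ε := by
  have : edist (a +ᵥ x) (a +ᵥ y) < ENNReal.ofReal ε :=
    lt_of_le_of_lt (le_iSup₂ (f := fun a _ => edist (a +ᵥ x) (a +ᵥ y)) a ha) h
  rw [edist_dist] at this
  exact (ENNReal.ofReal_lt_ofReal_iff_of_nonneg dist_nonneg).1 this

theorem coverNumber_mono_left {A B : Set (Rk k)} (h : A ⊆ B) (ε : ℝ) (K : Set X) :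
    coverNumber A ε K ≤ coverNumber B ε K := by
  refine le_iInf₂ fun s hs => iInf₂_le s (hs.trans (Set.iUnion₂_mono fun x _ y hy => ?_))
  exact lt_of_le_of_lt (biSup_mono fun _ ha => h ha) (show bowenDist B x y < _ from hy)

theorem coverNumber_mono_right (A : Set (Rk k)) (ε : ℝ) {K L : Set X} (h : K ⊆ L) :
    coverNumber A ε K ≤ coverNumber A ε L :=
  le_iInf₂ fun s hs => iInf₂_le s (h.trans hs)

theorem one_le_coverNumber (A : Set (Rk k)) (ε : ℝ) {K : Set X} (hK : K.Nonempty) :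
    1 ≤ coverNumber A ε K := by
  refine le_iInf₂ fun s hs => ?_
  obtain ⟨y, hy⟩ := hK
  obtain ⟨x, hx, -⟩ := Set.mem_iUnion₂.1 (hs hy)
  exact_mod_cast Finset.card_pos.2 ⟨x, hx⟩

theorem exists_cover_of_coverNumber_le {A : Set (Rk k)} {ε : ℝ} {K : Set X} {C : ℕ}
    (h : coverNumber A ε K ≤ C) :
    ∃ s : Finset X, K ⊆ ⋃ x ∈ s, bowenBall A x ε ∧ s.card ≤ C := by
  have h' : coverNumber A ε K < ((C + 1 : ℕ) : ℕ∞) :=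
    h.trans_lt (by exact_mod_cast Nat.lt_succ_self C)
  obtain ⟨s, hs⟩ := iInf_lt_iff.1 h'
  obtain ⟨hK, hs⟩ := iInf_lt_iff.1 hs
  exact ⟨s, hK, Nat.lt_succ_iff.1 (by exact_mod_cast hs)⟩

theorem growthRatio_of_coverNumber_eq {f : ℝ → ℝ} {A : Set (Rk k)} {ε : ℝ} {K : Set X} {N : ℕ}
    (hN : coverNumber A ε K = N) (h0 : N ≠ 0) :
    growthRatio f A ε K = ((Real.log N / f (volume A).toReal : ℝ) : EReal) := by
  rw [growthRatio, hN, EReal.coe_div, ENat.toENNReal_coe,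
    ENNReal.log_pos_real (by exact_mod_cast h0) (ENNReal.natCast_ne_top N), ENNReal.toReal_natCast]

theorem growthRatio_nonneg {f : ℝ → ℝ} {A : Set (Rk k)} {ε : ℝ} {K : Set X} (hK : K.Nonempty)
    (hf : 0 ≤ f (volume A).toReal) : 0 ≤ growthRatio f A ε K := by
  refine EReal.div_nonneg (ENNReal.zero_le_log_iff.2 ?_) (by exact_mod_cast hf)
  exact_mod_cast one_le_coverNumber A ε hK

theorem growthRatio_le {f : ℝ → ℝ} {A : Set (Rk k)} {ε : ℝ} {K : Set X} {C : ℕ} (hC : C ≠ 0)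
    (h : coverNumber A ε K ≤ C) (hf : 0 ≤ f (volume A).toReal) :
    growthRatio f A ε K ≤ ((Real.log C / f (volume A).toReal : ℝ) : EReal) := by
  have hlog : ((Real.log C : ℝ) : EReal) = ENNReal.log (C : ℝ≥0∞) := by
    rw [ENNReal.log_pos_real (by exact_mod_cast hC) (ENNReal.natCast_ne_top C),
      ENNReal.toReal_natCast]
  rw [EReal.coe_div, hlog]
  refine EReal.div_le_div_right_of_nonneg (by exact_mod_cast hf) (ENNReal.log_monotone ?_)
  exact_mod_cast ENat.toENNReal_le.2 h

end Cover

/-! ### Zero slow entropy and bounded covering numbers -/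

section Bounded

variable {k : ℕ} {X : Type*} [MetricSpace X] [AddAction (Rk k) X] {p : Seminorm ℝ (Rk k)}

theorem IsScale.eventually_pos {f : ℝ → ℝ} (hf : IsScale f) (hk : 1 ≤ k)
    (hp : ∀ v, p v = 0 → v = 0) : ∀ᶠ n in atTop, 0 < f (volume (normBalls p n)).toReal :=
  ((tendsto_volume_normBalls hk hp).eventually_gt_atTop 0).mono fun _ h => hf.pos _ h

theorem hasSlowEntropy_zero_of_bounded [Nonempty X] (hk : 1 ≤ k) (hp : ∀ v, p v = 0 → v = 0)
    [CompactSpace X]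
    (h : ∀ ε : ℝ, 0 < ε → ∃ C : ℕ, ∀ n, coverNumber (normBalls p n) ε (Set.univ : Set X) ≤ C)
    {f : ℝ → ℝ} (hf : IsScale f) : HasSlowEntropy X f (normBalls p) 0 := by
  have hpos := hf.eventually_pos hk hp
  have hup : upperSlowEntropy X f (normBalls p) ≤ 0 := by
    refine iSup₂_le fun K _ => iSup₂_le fun ε hε => ?_
    obtain ⟨C, hC⟩ := h ε hε
    have hC0 : C ≠ 0 := by
      rintro rfl
      exact absurd ((one_le_coverNumber _ ε Set.univ_nonempty).trans (hC 0)) (by simp)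
    have hlim : Tendsto (fun n => ((Real.log C / f (volume (normBalls p n)).toReal : ℝ) : EReal))
        atTop (𝓝 ((0 : ℝ) : EReal)) :=
      EReal.tendsto_coe.2 (tendsto_const_nhds.div_atTop
        (hf.tendsto.comp (tendsto_volume_normBalls hk hp)))
    rw [← EReal.coe_zero, ← hlim.limsup_eq]
    refine limsup_le_limsup (hpos.mono fun n hn => growthRatio_le hC0 ?_ hn.le)
    exact (coverNumber_mono_right _ ε (Set.subset_univ K)).trans (hC n)
  have hlow : 0 ≤ lowerSlowEntropy X f (normBalls p) := by
    refine le_trans ?_ (le_iSup₂_of_le Set.univ isCompact_univ (le_iSup₂_of_le 1 one_pos le_rfl))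
    exact le_liminf_of_le (by isBoundedDefault)
      (hpos.mono fun n hn => growthRatio_nonneg Set.univ_nonempty hn.le)
  have hle : lowerSlowEntropy X f (normBalls p) ≤ upperSlowEntropy X f (normBalls p) :=
    iSup₂_mono fun _ _ => iSup₂_mono fun _ _ => liminf_le_limsup
  exact ⟨hup.antisymm (hlow.trans hle), (hle.trans hup).antisymm hlow⟩

/-- A nondecreasing unbounded sequence of positive reals is interpolated, along a strictly
increasing sequence of volumes tending to infinity, by a scaling function. -/
theorem exists_isScale_interpolating {v u : ℕ → ℝ} (hv : StrictMono v) (hv0 : v 0 = 0)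
    (hvt : Tendsto v atTop atTop) (hu : Monotone u) (hu0 : 0 < u 0)
    (hut : Tendsto u atTop atTop) : ∃ f, IsScale f ∧ ∀ n, f (v n) = u n := by
  -- The supremum below is taken in ℕ, where unbounded sets get the value 0.
  have hbdd : ∀ x, BddAbove {n | v n ≤ x} := fun x => by
    obtain ⟨N, hN⟩ := (hvt.eventually_gt_atTop x).exists_forall_of_atTop
    exact ⟨N, fun n hn => le_of_not_ge fun h => (hN n h).not_ge hn⟩
  refine ⟨fun x => u (sSup {n | v n ≤ x}), ⟨fun x _ => hu0.trans_le (hu (Nat.zero_le _)),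
    fun x hx y _ hxy => hu (csSup_le_csSup (hbdd y) ⟨0, ?_⟩ fun n hn => le_trans hn hxy), ?_⟩,
    fun n => ?_⟩
  · exact hv0.trans_le (le_of_lt hx)
  · refine hut.comp (tendsto_atTop.2 fun n => ?_)
    exact (eventually_ge_atTop (v n)).mono fun x hx => le_csSup (hbdd x) hx
  · have : {m | v m ≤ v n} = Set.Iic n := Set.ext fun m => hv.le_iff_le
    simp only [this, csSup_Iic]

theorem isScale_id : IsScale id :=
  ⟨fun _ h => h, monotoneOn_id, tendsto_id⟩

theorem eventually_growthRatio_lt [CompactSpace X] {f : ℝ → ℝ} {F : ℕ → Set (Rk k)}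
    (h : HasSlowEntropy X f F 0) {ε : ℝ} (hε : 0 < ε) {c : EReal} (hc : 0 < c) :
    ∀ᶠ n in atTop, growthRatio f (F n) ε (Set.univ : Set X) < c := by
  refine eventually_lt_of_limsup_lt (lt_of_le_of_lt ?_ hc)
  rw [← h.1]
  exact le_iSup₂_of_le Set.univ isCompact_univ (le_iSup₂_of_le ε hε le_rfl)

theorem bounded_coverNumber_of_hasSlowEntropy_zero [Nonempty X] [CompactSpace X] (hk : 1 ≤ k)
    (hp : ∀ v, p v = 0 → v = 0)
    (h : ∀ f : ℝ → ℝ, IsScale f → HasSlowEntropy X f (normBalls p) 0) {ε : ℝ} (hε : 0 < ε) :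
    ∃ C : ℕ, ∀ n, coverNumber (normBalls p n) ε (Set.univ : Set X) ≤ C := by
  have hmono : Monotone fun n => coverNumber (normBalls p n) ε (Set.univ : Set X) :=
    fun m n hmn => coverNumber_mono_left (normBalls_mono p hmn) ε _
  -- One infinite covering number would make all later ratios infinite, already at the scale `id`.
  have hfin : ∀ n, coverNumber (normBalls p n) ε (Set.univ : Set X) ≠ ⊤ := fun n htop => by
    obtain ⟨m, ⟨hm, hpos⟩, hnm⟩ := (((eventually_growthRatio_lt (h id isScale_id) hε
      one_pos).and (isScale_id.eventually_pos hk hp)).and (eventually_ge_atTop n)).exists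
    have hm' := top_le_iff.1 (htop.symm.trans_le (hmono hnm))
    simp only at hm'
    rw [growthRatio, hm', ENat.toENNReal_top, ENNReal.log_top,
      EReal.top_div_of_pos_ne_top (by exact_mod_cast hpos) (EReal.coe_ne_top _)] at hm
    exact not_top_lt hm
  choose N hN using fun n => ENat.ne_top_iff_exists.1 (hfin n)
  have hNmono : Monotone N := fun m n hmn => by
    have := hmono hmn
    simp only [← hN] at this
    exact_mod_cast this
  have hNpos : ∀ n, 1 ≤ N n := fun n => by
    have := one_le_coverNumber (normBalls p n) ε (Set.univ_nonempty (α := X))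
    rw [← hN] at this
    exact_mod_cast this
  by_contra! hunb
  have hNt : Tendsto N atTop atTop := tendsto_atTop_atTop_of_monotone hNmono fun C => by
    obtain ⟨n, hn⟩ := hunb C
    rw [← hN] at hn
    exact ⟨n, le_of_lt (by exact_mod_cast hn)⟩
  have hlogt : Tendsto (fun n => Real.log (N n)) atTop atTop :=
    Real.tendsto_log_atTop.comp (tendsto_natCast_atTop_atTop.comp hNt)
  obtain ⟨f, hf, hfv⟩ := exists_isScale_interpolating (u := fun n => 1 + Real.log (N n))
    (strictMono_volume_normBalls hk hp)
    (by simp [volume_normBalls hk hp 0, show k ≠ 0 by omega]) (tendsto_volume_normBalls hk hp)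
    (fun m n hmn => by
      have h1 : (0 : ℝ) < N m := by exact_mod_cast hNpos m
      have h2 : (N m : ℝ) ≤ N n := by exact_mod_cast hNmono hmn
      simpa using Real.log_le_log h1 h2)
    (add_pos_of_pos_of_nonneg one_pos (Real.log_natCast_nonneg _))
    (tendsto_atTop_add_const_left _ _ hlogt)
  -- The added 1 keeps the scale positive; once log N > 1, the ratio log N / (1 + log N) exceeds
  -- 1/2.
  obtain ⟨n, hn, hlog⟩ := ((eventually_growthRatio_lt (h f hf) hε (c := ((1 / 2 : ℝ) : EReal))
    (by exact_mod_cast one_half_pos)).and (hlogt.eventually_gt_atTop 1)).exists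
  rw [growthRatio_of_coverNumber_eq (hN n).symm (by have := hNpos n; omega), hfv,
    EReal.coe_lt_coe_iff, div_lt_iff₀ (by linarith)] at hn
  linarith

end Bounded

/-! ### From bounded covers to equicontinuity -/

section Equicontinuous

variable {k : ℕ} {X : Type*} [MetricSpace X] [CompactSpace X] [AddAction (Rk k) X]

/-- If finitely many, and boundedly many, Bowen balls of radius `ε` cover along an exhausting
sequence of sets, then finitely many closed Bowen balls for the whole group cover. -/
theorem exists_finite_cover_of_bounded [Nonempty X] [ContinuousVAdd (Rk k) X]
    {F : ℕ → Set (Rk k)} (hF : ∀ a, ∀ᶠ n in atTop, a ∈ F n) {ε : ℝ} {C : ℕ}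
    (h : ∀ n, coverNumber (F n) ε (Set.univ : Set X) ≤ C) :
    ∃ z : Fin C → X, ∀ y, ∃ i, ∀ a : Rk k, dist (a +ᵥ z i) (a +ᵥ y) ≤ ε := by
  have h1 : ∀ n, ∃ c : Fin C → X, ∀ y, ∃ i, ∀ a ∈ F n, dist (a +ᵥ c i) (a +ᵥ y) ≤ ε := fun n => by
    obtain ⟨s, hs, hcard⟩ := exists_cover_of_coverNumber_le (h n)
    -- Padding with an arbitrary point puts all tuples of centres in the same compact space X^C.
    refine ⟨fun i => if hi : (i : ℕ) < s.card then s.equivFin.symm ⟨i, hi⟩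
      else Classical.arbitrary X, fun y => ?_⟩
    obtain ⟨x, hx, hy⟩ := Set.mem_iUnion₂.1 (hs (Set.mem_univ y))
    refine ⟨⟨s.equivFin ⟨x, hx⟩, (s.equivFin ⟨x, hx⟩).2.trans_le hcard⟩, fun a ha => ?_⟩
    simpa using (dist_lt_of_mem_bowenBall hy ha).le
  choose c hc using h1
  obtain ⟨z, -, hz⟩ := isCompact_univ.ultrafilter_le_nhds ((hyperfilter ℕ).map c) (by simp)
  refine ⟨z, fun y => ?_⟩
  -- The index of the ball containing y depends on n; the ultrafilter selects one index valid for
  -- almost all n.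
  obtain ⟨i, hi⟩ := Ultrafilter.eventually_exists_iff.1
    (Eventually.of_forall (f := (hyperfilter ℕ : Filter ℕ)) fun n => hc n y)
  refine ⟨i, fun a => ?_⟩
  have hlim : Tendsto (fun n => dist (a +ᵥ c n i) (a +ᵥ y)) (hyperfilter ℕ)
      (𝓝 (dist (a +ᵥ z i) (a +ᵥ y))) := by
    have hzi : Tendsto (fun n => c n i) (hyperfilter ℕ) (𝓝 (z i)) :=
      (continuous_apply i).continuousAt.tendsto.comp hz
    exact (hzi.const_vadd a).dist tendsto_const_nhds
  refine le_of_tendsto hlim ?_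
  filter_upwards [hi, Nat.hyperfilter_le_atTop (hF a)] with n hn ha using hn a ha

/-- One of the finitely many closed sets has interior; minimality moves x into it by some b, and the
invariance of the whole group under shifts by b carries the estimate back to x. -/
theorem uniformEquicontinuous_of_finite_cover [Nonempty X] [ContinuousVAdd (Rk k) X]
    [AddAction.IsMinimal (Rk k) X]
    (h : ∀ ε : ℝ, 0 < ε → ∃ (C : ℕ) (z : Fin C → X), ∀ y, ∃ i, ∀ a : Rk k,
      dist (a +ᵥ z i) (a +ᵥ y) ≤ ε) :
    UniformEquicontinuous fun (a : Rk k) (x : X) => a +ᵥ x := by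
  refine CompactSpace.uniformEquicontinuous_of_equicontinuous fun x => ?_
  rw [Metric.equicontinuousAt_iff_right]
  intro ε hε
  obtain ⟨C, z, hz⟩ := h (ε / 3) (by positivity)
  obtain ⟨i, hi⟩ := nonempty_interior_of_iUnion_of_closed
    (f := fun i => {y | ∀ a : Rk k, dist (a +ᵥ z i) (a +ᵥ y) ≤ ε / 3})
    (fun i => by
      simp only [Set.ofPred_forall]
      exact isClosed_iInter fun a =>
        isClosed_le (continuous_const.dist (continuous_const_vadd a)) continuous_const)
    (Set.eq_univ_of_forall fun y => Set.mem_iUnion.2 (hz y))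
  obtain ⟨b, hb⟩ := isOpen_interior.exists_vadd_mem (Rk k) x hi
  filter_upwards [(continuous_const_vadd b).continuousAt (isOpen_interior.mem_nhds hb)] with y hy a
  have key : ∀ w : X, a +ᵥ w = (a - b) +ᵥ (b +ᵥ w) := fun w => by rw [vadd_vadd, sub_add_cancel]
  have hx' := interior_subset hb (a - b)
  have hy' := interior_subset hy (a - b)
  simp only [key x, key y]
  calc _ ≤ _ := dist_triangle_left _ _ ((a - b) +ᵥ z i)
    _ ≤ ε / 3 + ε / 3 := add_le_add hx' hy'
    _ < ε := by linarith

end Equicontinuous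

/-! ### The group structure on X -/

section OrbitGroup

universe u

/-- The acting group, lifted to the universe of the space, to be endowed with the uniform structure
induced by the orbit map of a point. -/
def OrbitGroup {k : ℕ} {X : Type u} (_ : X) : Type u := ULift.{u} (Rk k)

variable {k : ℕ} {X : Type u}

instance (x₀ : X) : AddCommGroup (OrbitGroup (k := k) x₀) :=
  inferInstanceAs (AddCommGroup (ULift (Rk k)))

variable [AddAction (Rk k) X]

/-- The orbit map. -/
def OrbitGroup.toSpace (x₀ : X) (a : OrbitGroup (k := k) x₀) : X := ULift.down a +ᵥ x₀

/-- The lift of the acting group. -/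
def OrbitGroup.of (x₀ : X) : Rk k →+ OrbitGroup (k := k) x₀ where
  toFun := ULift.up
  map_zero' := rfl
  map_add' _ _ := rfl

variable [MetricSpace X]

instance (x₀ : X) : UniformSpace (OrbitGroup (k := k) x₀) :=
  UniformSpace.comap (OrbitGroup.toSpace x₀) inferInstance

theorem OrbitGroup.isUniformInducing_toSpace (x₀ : X) :
    IsUniformInducing (OrbitGroup.toSpace (k := k) x₀) := ⟨rfl⟩

theorem OrbitGroup.continuous_of [ContinuousVAdd (Rk k) X] (x₀ : X) :
    Continuous (OrbitGroup.of (k := k) x₀) :=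
  (isUniformInducing_toSpace x₀).isInducing.continuous_iff.2
    (continuous_id.vadd continuous_const)

theorem OrbitGroup.isUniformAddGroup
    (h : UniformEquicontinuous fun (a : Rk k) (x : X) => a +ᵥ x) (x₀ : X) :
    IsUniformAddGroup (OrbitGroup (k := k) x₀) := by
  refine ⟨(isUniformInducing_toSpace x₀).uniformContinuous_iff.2 ?_⟩
  have hcoe := (isUniformInducing_toSpace (k := k) x₀).uniformContinuous
  have hfst := hcoe.comp (uniformContinuous_fst (β := OrbitGroup (k := k) x₀))
  have hsnd := hcoe.comp (uniformContinuous_snd (α := OrbitGroup (k := k) x₀))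
  intro s hs
  obtain ⟨ε, hε, hs⟩ := Metric.mem_uniformity_dist.1 hs
  obtain ⟨δ, hδ, hd⟩ := Metric.uniformEquicontinuous_iff.1 h (ε / 2) (half_pos hε)
  rw [mem_map]
  filter_upwards [mem_map.1 (hfst (Metric.dist_mem_uniformity hδ)),
    mem_map.1 (hsnd (Metric.dist_mem_uniformity hδ))] with ⟨⟨⟨a⟩, ⟨a'⟩⟩, ⟨⟨b⟩, ⟨b'⟩⟩⟩ h1 h2
  refine hs ?_
  have h1 : dist (a +ᵥ x₀) (b +ᵥ x₀) < δ := h1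
  have h2 : dist (a' +ᵥ x₀) (b' +ᵥ x₀) < δ := h2
  change dist ((a - a') +ᵥ x₀) ((b - b') +ᵥ x₀) < ε
  -- The path a - a', b - a', b - b' changes one entry at a time; commutativity makes each move a
  -- translate of a given close pair.
  have e1 := hd _ _ h1 (-a')
  have e2 := hd _ _ h2 (b - a' - b')
  simp only [vadd_vadd] at e1 e2
  rw [neg_add_eq_sub, neg_add_eq_sub] at e1
  rw [sub_add_cancel, sub_right_comm, sub_add_cancel, dist_comm] at e2
  linarith [dist_triangle ((a - a') +ᵥ x₀) ((b - a') +ᵥ x₀) ((b - b') +ᵥ x₀)]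

theorem isConjToTranslations_of_uniformEquicontinuous [CompactSpace X] [Nonempty X]
    [ContinuousVAdd (Rk k) X] [AddAction.IsMinimal (Rk k) X]
    (h : UniformEquicontinuous fun (a : Rk k) (x : X) => a +ᵥ x) : IsConjToTranslations k X := by
  let x₀ : X := Classical.arbitrary X
  have := OrbitGroup.isUniformAddGroup h x₀
  have hdense : DenseRange (OrbitGroup.toSpace (k := k) x₀) :=
    (denseRange_vadd (Rk k) x₀).mono (Set.range_subset_iff.2 fun a => ⟨OrbitGroup.of x₀ a, rfl⟩)
  -- X is compact, hence complete, and the orbit is dense, so X is a completion; uniqueness of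
  -- completions yields `e`.
  let pkg : AbstractCompletion (OrbitGroup (k := k) x₀) :=
    ⟨X, OrbitGroup.toSpace x₀, inferInstance, inferInstance, inferInstance,
      OrbitGroup.isUniformInducing_toSpace x₀, hdense⟩
  let e : X ≃ₜ UniformSpace.Completion (OrbitGroup (k := k) x₀) :=
    @UniformEquiv.toHomeomorph _ _ _ UniformSpace.Completion.cPkg.uniformStruct
      (pkg.compareEquiv UniformSpace.Completion.cPkg)
  have he : ∀ a : OrbitGroup (k := k) x₀, e (OrbitGroup.toSpace x₀ a) = a :=
    pkg.compare_coe UniformSpace.Completion.cPkg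
  refine ⟨UniformSpace.Completion (OrbitGroup (k := k) x₀), inferInstance, inferInstance,
    inferInstance, e.compactSpace, inferInstance,
    UniformSpace.Completion.toCompl.comp (OrbitGroup.of x₀), e,
    (UniformSpace.Completion.continuous_coe _).comp (OrbitGroup.continuous_of x₀), fun a x => ?_⟩
  refine isClosed_property hdense (isClosed_eq (e.continuous.comp (continuous_const_vadd a))
    (continuous_const.add e.continuous)) (fun b => ?_) x
  have hb : a +ᵥ OrbitGroup.toSpace x₀ b = OrbitGroup.toSpace x₀ (OrbitGroup.of x₀ a + b) :=
    vadd_vadd _ _ _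
  change e (a +ᵥ OrbitGroup.toSpace x₀ b) = _ + e (OrbitGroup.toSpace x₀ b)
  rw [hb, he, he, UniformSpace.Completion.coe_add]
  rfl

end OrbitGroup

/-! ### Translations have bounded covering numbers -/

section Translations

variable {k : ℕ} {X : Type*} [MetricSpace X] [CompactSpace X] [AddAction (Rk k) X]

theorem IsConjToTranslations.bounded_coverNumber (h : IsConjToTranslations k X) {ε : ℝ}
    (hε : 0 < ε) : ∃ C : ℕ, ∀ A : Set (Rk k), coverNumber A ε (Set.univ : Set X) ≤ C := by
  obtain ⟨G, _, _, _, _, _, φ, e, -, he⟩ := h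
  let _ := IsTopologicalAddGroup.rightUniformSpace G
  have hu : UniformContinuous e.symm :=
    CompactSpace.uniformContinuous_of_continuous e.symm.continuous
  have hU := hu (Metric.dist_mem_uniformity (half_pos hε))
  rw [mem_map, uniformity_eq_comap_nhds_zero] at hU
  obtain ⟨U, hU0, hU⟩ := hU
  have hdist : ∀ x y : X, e y - e x ∈ U → dist x y < ε / 2 := fun x y hxy => by
    simpa using hU (show (e x, e y) ∈ _ from hxy)
  obtain ⟨s, -, hs⟩ := (isCompact_univ (X := X)).elim_nhds_subcover
    (fun x => {y | e y - e x ∈ U}) fun x _ =>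
      (e.continuous.sub continuous_const).continuousAt (by simpa using hU0)
  refine ⟨s.card, fun A => iInf₂_le s fun y hy => ?_⟩
  obtain ⟨x, hx, hxy⟩ := Set.mem_iUnion₂.1 (hs hy)
  refine Set.mem_iUnion₂.2 ⟨x, hx, mem_bowenBall_of_forall_dist_le hε (half_lt_self hε)
    fun a _ => (hdist _ _ ?_).le⟩
  -- The difference in G is the same at every time a, so the bound does not depend on A.
  rw [he, he, add_sub_add_left_eq_sub]
  exact hxy

end Translations

end SlowEntropy

open SlowEntropy in
theorem propositionB2 {k : ℕ} (hk : 1 ≤ k) (X : Type*) [MetricSpace X] [CompactSpace X]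
    [Nonempty X] [AddAction (Rk k) X] [ContinuousVAdd (Rk k) X]
    (p : Seminorm ℝ (Rk k)) (hp : ∀ v, p v = 0 → v = 0) :
    (AddAction.IsMinimal (Rk k) X →
      ((∀ f : ℝ → ℝ, IsScale f → HasSlowEntropy X f (normBalls p) 0) ↔
        IsConjToTranslations k X)) ∧
    (IsConjToTranslations k X →
      ∀ f : ℝ → ℝ, IsScale f → HasSlowEntropy X f (normBalls p) 0) := by
  have hif : IsConjToTranslations k X →
      ∀ f : ℝ → ℝ, IsScale f → HasSlowEntropy X f (normBalls p) 0 := fun h f hf =>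
    hasSlowEntropy_zero_of_bounded hk hp
      (fun ε hε => (h.bounded_coverNumber hε).imp fun C hC n => hC _) hf
  refine ⟨fun _ => ⟨fun h => ?_, hif⟩, hif⟩
  refine isConjToTranslations_of_uniformEquicontinuous
    (uniformEquicontinuous_of_finite_cover fun ε hε => ?_)
  obtain ⟨C, hC⟩ := bounded_coverNumber_of_hasSlowEntropy_zero hk hp h hε
  refine ⟨C, exists_finite_cover_of_bounded (fun a => ?_) hC⟩
  obtain ⟨m, hm⟩ := exists_nat_ge (p a)
  exact (eventually_ge_atTop m).mono fun n hn => normBalls_mono p hn hm
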